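/- Let $\Gamma$ be a countable discrete group that is amenable, i.e. that has a left Følner sequence: a sequence $(F_n)_{n\in\mathbb N}$ of nonempty finite subsets of $\Gamma$ with $|KF_n\,\triangle\,F_n|/|F_n|\to 0$ for every nonempty finite $K\subseteq\Gamma$. All actions below are continuous actions of $\Gamma$ on nonempty compact metrizable spaces, and $\rho$ denotes a compatible metric on the space in question; none of the following notions depends on the choice of $\rho$. * An action $\Gamma\curvearrowright X$ is *expansive* if there is $\kappa>0$ with $\sup_{s\in\Gamma}\rho(sx,sy)>\kappa$ for all distinct $x,y\in X$. * It has the *weak specification property* if for every $\varepsilon>0$ there is a nonempty finite set $F\subseteq\Gamma$ with $F=F^{-1}$ such that for every finite collection $(K_j)_{j\in J}$ of finite subsets of $\Gamma$ with $FK_i\cap K_j=\emptyset$ for all distinct $i,j\in J$, and every collection $(x_j)_{j\in J}$ of points of $X$, there is $x\in X$ with $\rho(sx,sx_j)\le\varepsilon$ for all $j\in J$ and $s\in K_j$. * For a finite open cover $\mathcal U$ of $X$ let $N(\mathcal U)$ be the minimal number of elements of $\mathcal U$ needed to cover $X$. The *topological entropy* is $h_{\rm top}(X)=\sup_{\mathcal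 U}\lim_{n\to\infty}\frac1{|F_n|}\log N\bigl(\bigvee_{s\in F_n}s^{-1}\mathcal U\bigr)\in[0,\infty]$, the supremum being over all finite open covers $\mathcal U$ of $X$; the limits exist and do not depend on the left Følner sequence $(F_n)$. * Points $x,y\in X$ are *homoclinic* if $\rho(sx,sy)\to0$ as $s\to\infty$ in $\Gamma$; this is an equivalence relation. A map from $X$ to another space is *pre-injective* if it is injective on every homoclinic equivalence class. * The action $\Gamma\curvearrowright X$ has the *Myhill property* if every pre-injective continuous $\Gamma$-equivariant map $X\to X$ is surjective, and it is *surjunctive* if every injective continuous $\Gamma$-equivariant map $X\to X$ is surjective. **Theorem.** (1) Let $\Gamma\curvearrowright X$ and $\Gamma\curvearrowright Y$ be expansive actions with the weak specification property such that $h_{\rm top}(X)=h_{\rm top}(Y)$. Then every pre-injective continuous $\Gamma$-equivariant map $X\to Y$ is surjective. (2) Every expansive action of $\Gamma$ with the weak specification property has the Myhill property; in particular, it is surjunctive. -/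

import Mathlib

open Filter Topology
open scoped Pointwise symmDiff

noncomputable section

namespace GardenOfEden

open scoped Classical in
/-- A left Følner sequence of a discrete group: nonempty finite sets `F n` with
`|K F n ∆ F n| / |F n| → 0` for every nonempty finite set `K`. -/
structure IsLeftFolner {Γ : Type*} [Group Γ] (F : ℕ → Finset Γ) : Prop where
  nonempty : ∀ n, (F n).Nonempty
  tendsto : ∀ K : Finset Γ, K.Nonempty →
    Tendsto (fun n => (((K * F n) ∆ F n).card : ℝ) / ((F n).card : ℝ)) atTop (𝓝 0)

/-- Amenability of a (countable, discrete) group. -/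
def IsAmenable (Γ : Type*) [Group Γ] : Prop :=
  ∃ F : ℕ → Finset Γ, IsLeftFolner F

section Metric

variable (Γ : Type*) [Group Γ] (X : Type*) [MetricSpace X] [MulAction Γ X]

/-- Expansiveness: some `κ > 0` satisfies `sup_s ρ(s x, s y) > κ` for all distinct `x, y`. -/
def IsExpansive : Prop :=
  ∃ κ : ℝ, 0 < κ ∧ ∀ x y : X, x ≠ y → ∃ s : Γ, κ < dist (s • x) (s • y)

open scoped Classical in
/-- The weak specification property. Finite collections are indexed by `Fin m`; the empty
collection (`m = 0`) is included, so that the property entails that `X` is nonempty. -/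
def WeakSpecification : Prop :=
  ∀ ε : ℝ, 0 < ε → ∃ F : Finset Γ, F.Nonempty ∧ F⁻¹ = F ∧
    ∀ (m : ℕ) (K : Fin m → Finset Γ) (x : Fin m → X),
      (∀ i j, i ≠ j → Disjoint (F * K i) (K j)) →
      ∃ z : X, ∀ j, ∀ s ∈ K j, dist (s • z) (s • x j) ≤ ε

variable {X}

/-- Homoclinic (asymptotic) pairs: `ρ(s x, s y) → 0` as `s → ∞` in the discrete group `Γ`. -/
def IsHomoclinic (x y : X) : Prop :=
  Tendsto (fun s : Γ => dist (s • x) (s • y)) cofinite (𝓝 0)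

/-- Pre-injectivity: injectivity on every homoclinic equivalence class. -/
def PreInjective {Y : Type*} (T : X → Y) : Prop :=
  ∀ x : X, Set.InjOn T {y | IsHomoclinic Γ x y}

variable (X)

/-- The Myhill property: every pre-injective continuous equivariant self-map is surjective. -/
def MyhillProperty : Prop :=
  ∀ T : X →[Γ] X, Continuous T → PreInjective Γ T → Function.Surjective T

/-- Surjunctivity: every injective continuous equivariant self-map is surjective. -/
def IsSurjunctive : Prop :=
  ∀ T : X →[Γ] X, Continuous T → Function.Injective T → Function.Surjective T

end Metric

section Entropy

/-- Finite open covers of `X`. -/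
structure IsFiniteOpenCover {X : Type*} [TopologicalSpace X] (U : Set (Set X)) : Prop where
  finite : U.Finite
  isOpen : ∀ V ∈ U, IsOpen V
  sUnion_eq : ⋃₀ U = Set.univ

/-- `N(U)`: the minimal number of elements of the cover `U` needed to cover `X`. -/
def coverNumber {X : Type*} (U : Set (Set X)) : ℕ :=
  sInf {k | ∃ V : Finset (Set X), (V : Set (Set X)) ⊆ U ∧
    ⋃₀ (V : Set (Set X)) = Set.univ ∧ V.card = k}

/-- The join `⋁_{s ∈ F} s⁻¹ U`: its elements are the sets `⋂_{s ∈ F} s⁻¹ (c s)`, where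
`c s ∈ U` for each `s ∈ F`. -/
def joinCover {Γ : Type*} [Group Γ] {X : Type*} [MulAction Γ X]
    (F : Finset Γ) (U : Set (Set X)) : Set (Set X) :=
  {W | ∃ c : Γ → Set X, (∀ s ∈ F, c s ∈ U) ∧ W = ⋂ s ∈ F, (fun x : X => s • x) ⁻¹' (c s)}

/-- `h(U) = lim_n (1 / |F n|) log N(⋁_{s ∈ F n} s⁻¹ U)`. For a left Følner sequence `F` the
limit exists and does not depend on `F`; it is written as an upper limit in the extended
reals. -/
def coverEntropy {Γ : Type*} [Group Γ] {X : Type*} [MulAction Γ X]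
    (F : ℕ → Finset Γ) (U : Set (Set X)) : EReal :=
  limsup (fun n =>
    ((Real.log (coverNumber (joinCover (F n) U) : ℝ) / ((F n).card : ℝ) : ℝ) : EReal)) atTop

/-- Topological entropy of the action of `Γ` on `X`: the supremum of `h(U)` over all finite
open covers `U`, computed along the left Følner sequence `F`. -/
def topEntropy {Γ : Type*} [Group Γ] (F : ℕ → Finset Γ)
    (X : Type*) [TopologicalSpace X] [MulAction Γ X] : EReal :=
  ⨆ (U : Set (Set X)) (_ : IsFiniteOpenCover U), coverEntropy F U

end Entropy

end GardenOfEden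

end

open GardenOfEden

/-!
A pre-injective map `T : X → Y` that misses a point of `Y` would force `h(X) < h(Y)`. All entropy
estimates are made by counting finite sets of points that are separated on a finite `K ⊆ Γ`.

By expansiveness of `X`, the entropy of every finite open cover is bounded by the number of points
separated at one fixed scale (`exists_subcover_card_le`). Weak specification in `X` replaces a
separated set by one whose points all shadow a common point outside a finite set, hence are pairwise
homoclinic; so `T` is injective on it, and expansiveness of `Y` makes its image separated on a set
`D K` only slightly larger than `K` (`exists_image_separatedOn`). Along a Følner sequence, passing
from `D (F n)` back to `F n` costs a subexponential factor (`exists_separatedOn_of_union`). Finally,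
`T X` is a proper closed invariant subset of `Y`, and weak specification in `Y` lets the orbits in
`T X` be rerouted through a neighbourhood of a missed point at an arbitrary set of well-spaced
times, which multiplies the number of separated points by a factor exponential in `|F n|`
(`exists_separatedOn_card_exp_le`). Compared with a cover of `Y` of small mesh, this bounds
`h(X)` by `h(Y) - c / 2` with `c > 0`, while `h(Y)` is finite.
-/

open GardenOfEden

namespace GardenOfEden

section Separated

open scoped Classical

universe u v w

variable {Γ : Type u} [Group Γ] {X : Type v} [MetricSpace X] [MulAction Γ X]

/-! ### Separated sets -/

/-- A finite set `P` is `δ`-separated on `K ⊆ Γ` if any two distinct points of `P` are moved to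
distance more than `δ` by some element of `K`. -/
def IsSeparatedOn (δ : ℝ) (K : Finset Γ) (P : Finset X) : Prop :=
  ∀ x ∈ P, ∀ y ∈ P, x ≠ y → ∃ s ∈ K, δ < dist (s • x) (s • y)

/-- For symmetric `F`, the condition in the specification property is symmetric in the two sets. -/
theorem disjoint_mul_symm {F K L : Finset Γ} (hF : F⁻¹ = F) (h : Disjoint (F * K) L) :
    Disjoint (F * L) K := by
  rw [Finset.disjoint_left] at h ⊢
  intro a ha hK
  obtain ⟨f, hf, l, hl, rfl⟩ := Finset.mem_mul.1 ha
  refine h (a := l) ?_ hl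
  refine Finset.mem_mul.2 ⟨f⁻¹, ?_, f * l, hK, by simp⟩
  rw [← hF]
  exact Finset.inv_mem_inv hf

/-- Passing to the most frequent itinerary through a partition of mesh `δ` along `L` removes
`L` from the set on which the points are separated, at the cost of a factor `C ^ |L|`. -/
theorem exists_separatedOn_of_union [CompactSpace X] {δ : ℝ} (hδ : 0 < δ) :
    ∃ C : ℕ, 0 < C ∧ ∀ (K L : Finset Γ) (P : Finset X), IsSeparatedOn δ (K ∪ L) P →
      ∃ Q ⊆ P, IsSeparatedOn δ K Q ∧ P.card ≤ Q.card * C ^ L.card := by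
  obtain ⟨t, -, htf, ht⟩ := finite_cover_balls_of_compact (X := X) isCompact_univ (half_pos hδ)
  have hc : ∀ x : X, ∃ y : t, dist x y < δ / 2 := by
    intro x
    obtain ⟨y, hy, hxy⟩ := Set.mem_iUnion₂.1 (ht (Set.mem_univ x))
    exact ⟨⟨y, hy⟩, hxy⟩
  choose c hc using hc
  have : Fintype t := htf.fintype
  refine ⟨Fintype.card (Option t), Fintype.card_pos, fun K L P hP => ?_⟩
  let f : X → (L → Option t) := fun x s => some (c ((s : Γ) • x))
  obtain ⟨b, -, hb⟩ := Finset.exists_max_image (Finset.univ : Finset (L → Option t))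
    (fun b => (P.filter fun x => f x = b).card) Finset.univ_nonempty
  refine ⟨P.filter fun x => f x = b, Finset.filter_subset _ _, ?_, ?_⟩
  · intro x hx y hy hxy
    rw [Finset.mem_filter] at hx hy
    obtain ⟨s, hs, hsd⟩ := hP x hx.1 y hy.1 hxy
    rcases Finset.mem_union.1 hs with hs | hs
    · exact ⟨s, hs, hsd⟩
    · exfalso
      have h1 : c (s • x) = c (s • y) :=
        Option.some_injective _ (congrFun (hx.2.trans hy.2.symm) ⟨s, hs⟩)
      have h2 := hc (s • x)
      have h3 := hc (s • y)
      rw [← h1] at h3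
      have := dist_triangle_right (s • x) (s • y) (c (s • x) : X)
      linarith
  · have := Finset.card_le_mul_card_image_of_maps_to (s := P) (f := f) (t := Finset.univ)
      (fun _ _ => Finset.mem_univ _) _ (fun b' _ => hb b' (Finset.mem_univ _))
    simpa using this

/-! ### Expansiveness and specification -/

/-- Uniform expansiveness: distances are controlled by finitely many translates. -/
theorem exists_finset_dist_lt [CompactSpace X] [ContinuousConstSMul Γ X] {κ : ℝ}
    (hκ : ∀ x y : X, x ≠ y → ∃ s : Γ, κ < dist (s • x) (s • y)) {r : ℝ} (hr : 0 < r) :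
    ∃ E : Finset Γ, ∀ x y : X, (∀ s ∈ E, dist (s • x) (s • y) ≤ κ) → dist x y < r := by
  have hcpt : IsCompact {p : X × X | r ≤ dist p.1 p.2} :=
    (isClosed_le continuous_const continuous_dist).isCompact
  obtain ⟨E, hE⟩ := hcpt.elim_finite_subcover
    (fun s : Γ => {p : X × X | κ < dist (s • p.1) (s • p.2)})
    (fun s => isOpen_lt continuous_const
      ((continuous_fst.const_smul s).dist (continuous_snd.const_smul s)))
    (fun p hp => Set.mem_iUnion.2 (hκ p.1 p.2 (dist_pos.1 (hr.trans_le hp))))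
  refine ⟨E, fun x y h => ?_⟩
  by_contra! hxy
  obtain ⟨s, hs, hsd⟩ := Set.mem_iUnion₂.1 (hE (show (x, y) ∈ _ from hxy))
  exact absurd (h s hs) (not_le.2 hsd)

/-- The specification property with `1 ∈ F`, for collections indexed by any finite type. -/
theorem WeakSpecification.exists_finset (h : WeakSpecification Γ X) {ε : ℝ} (hε : 0 < ε) :
    ∃ F : Finset Γ, 1 ∈ F ∧ F⁻¹ = F ∧
      ∀ (ι : Type w) [Finite ι] (K : ι → Finset Γ) (x : ι → X),
        (∀ i j, i ≠ j → Disjoint (F * K i) (K j)) →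
        ∃ z : X, ∀ j, ∀ s ∈ K j, dist (s • z) (s • x j) ≤ ε := by
  obtain ⟨F, -, hF, h⟩ := h ε hε
  refine ⟨insert 1 F, Finset.mem_insert_self _ _, ?_, fun ι _ K x hK => ?_⟩
  · rw [Finset.inv_insert, inv_one, hF]
  · obtain ⟨n, ⟨e⟩⟩ := Finite.exists_equiv_fin ι
    obtain ⟨z, hz⟩ := h n (K ∘ e.symm) (x ∘ e.symm) fun i j hij =>
      (hK _ _ (e.symm.injective.ne hij)).mono_left
        (Finset.mul_subset_mul_right (Finset.subset_insert _ _))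
    exact ⟨z, fun j s hs => by simpa using hz (e j) s (by simpa using hs)⟩

/-- By compactness, a point can be shadowed on a finite set `K` and another one on the whole
complement of `F K`. -/
theorem WeakSpecification.exists_finset_compl [CompactSpace X] [ContinuousConstSMul Γ X]
    (h : WeakSpecification Γ X) {ε : ℝ} (hε : 0 < ε) :
    ∃ F : Finset Γ, ∀ (K : Finset Γ) (x y : X), ∃ z : X,
      (∀ s ∈ K, dist (s • z) (s • x) ≤ ε) ∧ ∀ s ∉ F * K, dist (s • z) (s • y) ≤ ε := by
  obtain ⟨F, -, hF, h⟩ := WeakSpecification.exists_finset.{u, v, 0} h hε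
  have hclosed : ∀ (s : Γ) (x : X), IsClosed {z : X | dist (s • z) (s • x) ≤ ε} := fun s x =>
    isClosed_le ((continuous_const_smul s).dist continuous_const) continuous_const
  refine ⟨F, fun K x y => ?_⟩
  have hcpt : IsCompact (⋂ s ∈ K, {z : X | dist (s • z) (s • x) ≤ ε}) :=
    (isClosed_biInter fun s _ => hclosed s x).isCompact
  obtain ⟨z, hzK, hz⟩ := hcpt.inter_iInter_nonempty
    (fun s : {s : Γ // s ∉ F * K} => {z : X | dist ((s : Γ) • z) ((s : Γ) • y) ≤ ε})
    (fun s => hclosed s y) (fun L => by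
      have hL : Disjoint (F * K) (L.image Subtype.val) := by
        rw [Finset.disjoint_right]
        intro s hs
        obtain ⟨s, -, rfl⟩ := Finset.mem_image.1 hs
        exact s.2
      obtain ⟨z, hz⟩ := h Bool (fun b => cond b K (L.image Subtype.val)) (fun b => cond b x y)
        (by
          rintro (_ | _) (_ | _) hij
          · exact absurd rfl hij
          · exact disjoint_mul_symm hF hL
          · exact hL
          · exact absurd rfl hij)
      exact ⟨z, Set.mem_iInter₂.2 (hz true), Set.mem_iInter₂.2 fun s hs =>
        hz false s (Finset.mem_image_of_mem _ hs)⟩)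
  exact ⟨z, fun s hs => Set.mem_iInter₂.1 hzK s hs, fun s hs => Set.mem_iInter.1 hz ⟨s, hs⟩⟩

variable {Y : Type w} [MetricSpace Y] [MulAction Γ Y]

/-! ### Images of separated sets under pre-injective maps -/

/-- Shadow each point of a separated set on `K`, and one fixed point away from `K`. The resulting
points are pairwise homoclinic, so a pre-injective map keeps them distinct; and their images can
only be separated near `K`. -/
theorem exists_image_separatedOn [CompactSpace X] [ContinuousConstSMul Γ X]
    {κ κ' : ℝ} (hκ0 : 0 < κ) (hκ : ∀ x y : X, x ≠ y → ∃ s : Γ, κ < dist (s • x) (s • y))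
    (hX : WeakSpecification Γ X)
    (hκ0' : 0 < κ') (hκ' : ∀ x y : Y, x ≠ y → ∃ s : Γ, κ' < dist (s • x) (s • y))
    (T : X →[Γ] Y) (hT : Continuous T) (hinj : PreInjective Γ T) :
    ∃ D : Finset Γ, ∀ (K : Finset Γ) (P : Finset X), IsSeparatedOn κ K P →
      ∃ Q : Finset Y, (∀ q ∈ Q, q ∈ Set.range T) ∧ IsSeparatedOn κ' (D * K) Q ∧
        Q.card = P.card := by
  obtain ⟨F, hF⟩ := hX.exists_finset_compl (ε := κ / 3) (by positivity)
  obtain ⟨r, hr, hTr⟩ := Metric.uniformContinuous_iff.1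
    (CompactSpace.uniformContinuous_of_continuous hT) κ' hκ0'
  obtain ⟨E, hE⟩ := exists_finset_dist_lt hκ hr
  refine ⟨E⁻¹ * F, fun K P hP => ?_⟩
  rcases P.eq_empty_or_nonempty with rfl | ⟨x₀, -⟩
  · exact ⟨∅, by simp, by simp [IsSeparatedOn], rfl⟩
  choose z hzK hz using fun x => hF K x x₀
  have hfar : ∀ x y, ∀ s ∉ F * K, dist (s • z x) (s • z y) ≤ κ := fun x y s hs => by
    have := dist_triangle_right (s • z x) (s • z y) (s • x₀)
    have := hz x s hs
    have := hz y s hs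
    linarith
  have hnear : ∀ (E : Finset Γ) (x y : X), ∀ s ∉ E⁻¹ * F * K, ∀ t ∈ E,
      dist (t • s • z x) (t • s • z y) ≤ κ := fun E x y s hs t ht => by
    rw [smul_smul, smul_smul]
    refine hfar x y _ fun hts => hs ?_
    rw [mul_assoc]
    exact Finset.mem_mul.2 ⟨t⁻¹, Finset.inv_mem_inv ht, t * s, hts, by simp⟩
  have hhom : ∀ x y, IsHomoclinic Γ (z x) (z y) := fun x y => by
    refine Metric.tendsto_nhds.2 fun ε hε => ?_
    -- The displacement stays below `κ` on all of `E' s` once `s` leaves `E'⁻¹ F K`.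
    obtain ⟨E', hE'⟩ := exists_finset_dist_lt hκ hε
    refine (E'⁻¹ * F * K).finite_toSet.subset fun s hs => ?_
    by_contra hsK
    refine hs ?_
    simpa using hE' _ _ (hnear E' x y s hsK)
  have hzinj : Set.InjOn (fun x => T (z x)) P := by
    intro x hx y hy hxy
    have hzz : z x = z y := hinj (z x) (hhom x x) (hhom x y) hxy
    by_contra hne
    obtain ⟨s, hs, hsd⟩ := hP x hx y hy hne
    have := dist_triangle_left (s • x) (s • y) (s • z x)
    have h1 := hzK x s hs
    have h2 := hzK y s hs
    rw [← hzz] at h2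
    linarith
  refine ⟨P.image fun x => T (z x), ?_, ?_, Finset.card_image_of_injOn hzinj⟩
  · intro q hq
    obtain ⟨x, -, rfl⟩ := Finset.mem_image.1 hq
    exact ⟨_, rfl⟩
  · intro p hp q hq hpq
    obtain ⟨x, -, rfl⟩ := Finset.mem_image.1 hp
    obtain ⟨y, -, rfl⟩ := Finset.mem_image.1 hq
    obtain ⟨s, hs⟩ := hκ' _ _ hpq
    refine ⟨s, ?_, hs⟩
    by_contra hsK
    refine absurd (hTr (hE _ _ (hnear E x y s hsK))) (not_lt.2 ?_)
    rw [map_smul, map_smul]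
    exact hs.le

/-! ### Proper closed invariant subsets -/

/-- A subset of `K` maximal among those whose points are mutually `F`-apart has density at least
`1 / |F|`, since its translates by `F` cover `K`. -/
theorem exists_subset_apart {F : Finset Γ} (h1 : 1 ∈ F) (hF : F⁻¹ = F) (K : Finset Γ) :
    ∃ A ⊆ K, (∀ a ∈ A, ∀ b ∈ A, a ≠ b → b ∉ F * {a}) ∧ K.card ≤ F.card * A.card := by
  obtain ⟨p, hp⟩ : ∃ p : Finset Γ → Prop, ∀ A, p A ↔ ∀ a ∈ A, ∀ b ∈ A, a ≠ b → b ∉ F * {a} :=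
    ⟨_, fun _ => Iff.rfl⟩
  obtain ⟨A, hA, hmax⟩ := Finset.exists_max_image (K.powerset.filter p) Finset.card
    ⟨∅, by simp [hp]⟩
  rw [Finset.mem_filter, Finset.mem_powerset, hp] at hA
  refine ⟨A, hA.1, hA.2, (Finset.card_le_card fun g hg => ?_).trans Finset.card_mul_le⟩
  by_contra hgA
  have hgA' : g ∉ A := fun h => hgA (Finset.mem_mul.2 ⟨1, h1, g, h, one_mul _⟩)
  have hag : ∀ a ∈ A, g ∉ F * {a} := fun a ha h =>
    hgA (Finset.mul_subset_mul_left (Finset.singleton_subset_iff.2 ha) h)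
  have := hmax (insert g A) (by
    rw [Finset.mem_filter, Finset.mem_powerset, hp]
    refine ⟨Finset.insert_subset hg hA.1, ?_⟩
    intro a ha b hb hab
    rcases Finset.mem_insert.1 ha with rfl | ha' <;>
      rcases Finset.mem_insert.1 hb with rfl | hb'
    · exact absurd rfl hab
    · intro h
      have := disjoint_mul_symm (K := {b}) (L := {a}) hF
        (Finset.disjoint_singleton_right.2 (hag b hb'))
      exact Finset.disjoint_singleton_right.1 this h
    · exact hag a ha'
    · exact hA.2 a ha' b hb' hab)
  rw [Finset.card_insert_of_notMem hgA'] at this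
  omega

/-- A proper closed invariant subset `Z` carries exponentially fewer separated points than the
whole space. Fix `y₀ ∉ Z` and an `F`-apart set `A ⊆ K` of positive density. For each `B ⊆ A`,
points of `Z` are rerouted to pass near `y₀` exactly at the times in `B`. This costs a factor
`C ^ (|F| |B|)`, since separation on `F B` is forgotten; summing over `B` still gains
`∑ B ⊆ A, C ^ (-|F| |B|) = (1 + C ^ (-|F|)) ^ |A|`. -/
theorem exists_separatedOn_card_exp_le [CompactSpace X] (hX : WeakSpecification Γ X)
    {Z : Set X} (hZ : IsClosed Z) (hinv : ∀ (s : Γ), ∀ z ∈ Z, s • z ∈ Z) {y₀ : X} (hy₀ : y₀ ∉ Z)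
    {δ : ℝ} (hδ : 0 < δ) :
    ∃ δ' > 0, ∃ c > 0, ∀ (K : Finset Γ) (Q : Finset X), (∀ q ∈ Q, q ∈ Z) →
      IsSeparatedOn δ K Q → ∃ R : Finset X, IsSeparatedOn δ' K R ∧
        (Q.card : ℝ) * Real.exp (c * K.card) ≤ R.card := by
  obtain ⟨η, hη, hball⟩ := Metric.isOpen_iff.1 hZ.isOpen_compl y₀ hy₀
  have hfar : ∀ z ∈ Z, η ≤ dist z y₀ := fun z hz => by
    by_contra! h
    exact hball h hz
  set δ' := min δ η / 4
  have hδ' : 0 < δ' := by positivity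
  have hmin : 4 * δ' = min δ η := by simp only [δ']; ring
  have hδδ : 4 * δ' ≤ δ := hmin.trans_le (min_le_left _ _)
  have hδη : 4 * δ' ≤ η := hmin.trans_le (min_le_right _ _)
  obtain ⟨C, hC, hpig⟩ := exists_separatedOn_of_union (Γ := Γ) (X := X) hδ
  obtain ⟨F, h1, hF, hspec⟩ := WeakSpecification.exists_finset.{u, v, u} hX hδ'
  have hm : 0 < (F.card : ℝ) := by exact_mod_cast Finset.card_pos.2 ⟨1, h1⟩
  have hC0 : (0 : ℝ) < C := by exact_mod_cast hC
  set a : ℝ := ((C : ℝ) ^ F.card)⁻¹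
  have ha : 0 < a := by positivity
  have hlog : 0 < Real.log (1 + a) := Real.log_pos (by linarith)
  refine ⟨δ', hδ', Real.log (1 + a) / F.card, by positivity, fun K Q hQZ hQ => ?_⟩
  obtain ⟨A, hAK, hA, hcard⟩ := exists_subset_apart h1 hF K
  have hQB : ∀ B : Finset Γ, ∃ Q' ⊆ Q, IsSeparatedOn δ (K \ (F * B)) Q' ∧
      Q.card ≤ Q'.card * C ^ (F * B).card := fun B => hpig _ _ _ fun x hx y hy hxy => by
    obtain ⟨s, hs, hsd⟩ := hQ x hx y hy hxy
    exact ⟨s, by simp [hs], hsd⟩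
  choose Q' hQ'Q hQ' hQ'card using hQB
  -- Each `B ⊆ A` gets its own shadowing points; `b • z` near `y₀` means that `z`
  -- shadows `b⁻¹ • y₀` on `{b}`.
  have hz : ∀ (B : Finset Γ) (q : X), ∃ z : X, B ⊆ A →
      (∀ s ∈ K \ (F * B), dist (s • z) (s • q) ≤ δ') ∧ ∀ b ∈ B, dist (b • z) y₀ ≤ δ' := by
    intro B q
    by_cases hB : B ⊆ A
    · have hdisj : Disjoint (F * B) (K \ (F * B)) := Finset.disjoint_sdiff
      obtain ⟨z, hz⟩ := hspec (Option B) (fun i => i.elim (K \ (F * B)) fun b => {(b : Γ)})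
        (fun i => i.elim q fun b => (b : Γ)⁻¹ • y₀) (by
          have hsub : ∀ b : B, F * {(b : Γ)} ⊆ F * B := fun b =>
            Finset.mul_subset_mul_left (Finset.singleton_subset_iff.2 b.2)
          rintro (_ | i) (_ | j) hij
          · exact absurd rfl hij
          · exact (disjoint_mul_symm hF (hdisj.mono_left (hsub j)))
          · exact hdisj.mono_left (hsub i)
          · refine Finset.disjoint_singleton_right.2 (hA i (hB i.2) j (hB j.2) fun h => hij ?_)
            rw [Subtype.ext h])
      refine ⟨z, fun _ => ⟨hz none, fun b hb => ?_⟩⟩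
      simpa using hz (some ⟨b, hb⟩) b (Finset.mem_singleton_self b)
    · exact ⟨q, fun h => absurd h hB⟩
  choose z hz using hz
  -- For `a ∈ A`, passing near `y₀` or near `Z` at time `a` tells whether `a ∈ B`.
  have hdiff : ∀ B ⊆ A, ∀ B' ⊆ A, ∀ q, ∀ q' ∈ Q, ∀ a ∈ B, a ∉ B' →
      δ' < dist (a • z B q) (a • z B' q') := by
    intro B hB B' hB' q q' hq' a haB haB'
    have h2 := (hz B q hB).2 a haB
    have h3 := (hz B' q' hB').1 a (by
      refine Finset.mem_sdiff.2 ⟨hAK (hB haB), fun h => ?_⟩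
      obtain ⟨f, hf, b, hb, rfl⟩ := Finset.mem_mul.1 h
      refine hA b (hB' hb) _ (hB haB) (fun h => haB' (h ▸ hb)) ?_
      exact Finset.mul_mem_mul hf (Finset.mem_singleton_self b))
    have h4 := hfar _ (hinv a q' (hQZ q' hq'))
    have h5 := dist_triangle4 (a • q') (a • z B' q') (a • z B q) y₀
    rw [dist_comm (a • q') (a • z B' q'), dist_comm (a • z B' q') (a • z B q)] at h5
    linarith
  let I : Finset (Σ _ : Finset Γ, X) := A.powerset.sigma Q'
  have hI : ∀ i ∈ I, ∀ j ∈ I, i ≠ j →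
      ∃ s ∈ K, δ' < dist (s • z i.1 i.2) (s • z j.1 j.2) := by
    rintro ⟨B, q⟩ hi ⟨B', q'⟩ hj hij
    obtain ⟨hB, hq⟩ := Finset.mem_sigma.1 hi
    obtain ⟨hB', hq'⟩ := Finset.mem_sigma.1 hj
    simp only at hB hB' hq hq' ⊢
    rw [Finset.mem_powerset] at hB hB'
    by_cases hBB : B = B'
    · subst hBB
      have hqq : q ≠ q' := fun h => hij (by rw [h])
      obtain ⟨s, hs, hsd⟩ := hQ' B q hq q' hq' hqq
      refine ⟨s, (Finset.mem_sdiff.1 hs).1, ?_⟩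
      have h2 := (hz B q hB).1 s hs
      have h3 := (hz B q' hB).1 s hs
      have h5 := dist_triangle4 (s • q) (s • z B q) (s • z B q') (s • q')
      rw [dist_comm (s • q) (s • z B q)] at h5
      linarith
    · by_cases hsub : B ⊆ B'
      · obtain ⟨b, hb, hb'⟩ : ∃ b ∈ B', b ∉ B := by
          by_contra! h
          exact hBB (hsub.antisymm h)
        refine ⟨b, hAK (hB' hb), ?_⟩
        rw [dist_comm]
        exact hdiff B' hB' B hB q' q (hQ'Q _ hq) b hb hb'
      · obtain ⟨b, hb, hb'⟩ := Finset.not_subset.1 hsub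
        exact ⟨b, hAK (hB hb), hdiff B hB B' hB' q q' (hQ'Q _ hq') b hb hb'⟩
  refine ⟨I.image fun i => z i.1 i.2, ?_, ?_⟩
  · intro x hx y hy hxy
    obtain ⟨i, hi, rfl⟩ := Finset.mem_image.1 hx
    obtain ⟨j, hj, rfl⟩ := Finset.mem_image.1 hy
    exact hI i hi j hj fun h => hxy (by rw [h])
  · rw [Finset.card_image_of_injOn, Finset.card_sigma]
    · have hB : ∀ B ∈ A.powerset, (Q.card : ℝ) * a ^ B.card ≤ (Q' B).card := fun B _ => by
        have h2 : (Q.card : ℝ) ≤ (Q' B).card * (C : ℝ) ^ (F * B).card := by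
          exact_mod_cast hQ'card B
        have h3 : (C : ℝ) ^ (F * B).card ≤ ((C : ℝ) ^ F.card) ^ B.card := by
          rw [← pow_mul]
          exact pow_le_pow_right₀ (by exact_mod_cast hC) Finset.card_mul_le
        simp only [a]
        rw [inv_pow, ← div_eq_mul_inv, div_le_iff₀ (by positivity)]
        exact h2.trans (by gcongr)
      have hexp : Real.exp (Real.log (1 + a) / F.card * K.card) ≤ (1 + a) ^ A.card := by
        rw [← Real.exp_log (show 0 < 1 + a by linarith), ← Real.exp_nat_mul, Real.log_exp]
        refine Real.exp_le_exp.2 ?_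
        have : (K.card : ℝ) ≤ F.card * A.card := by exact_mod_cast hcard
        rw [div_mul_eq_mul_div, div_le_iff₀ hm]
        nlinarith
      calc (Q.card : ℝ) * Real.exp (Real.log (1 + a) / F.card * K.card)
          ≤ Q.card * (1 + a) ^ A.card := by gcongr
        _ = ∑ B ∈ A.powerset, (Q.card : ℝ) * a ^ B.card := by
          rw [← Finset.mul_sum, add_comm 1 a, ← Finset.sum_pow_mul_eq_add_pow]
          simp
        _ ≤ ∑ B ∈ A.powerset, ((Q' B).card : ℝ) := Finset.sum_le_sum hB
        _ = _ := by push_cast; rfl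
    · intro i hi j hj hij
      by_contra hne
      obtain ⟨s, -, hs⟩ := hI i hi j hj hne
      simp only at hij
      rw [hij, dist_self] at hs
      linarith

/-! ### Open covers and separated sets -/

/-- Points separated on the empty set are equal, so all of `K` can be forgotten. -/
theorem exists_card_separatedOn_le [CompactSpace X] {δ : ℝ} (hδ : 0 < δ) :
    ∃ C : ℕ, 0 < C ∧ ∀ (K : Finset Γ) (P : Finset X), IsSeparatedOn δ K P →
      P.card ≤ C ^ K.card := by
  obtain ⟨C, hC, hpig⟩ := exists_separatedOn_of_union (Γ := Γ) (X := X) hδ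
  refine ⟨C, hC, fun K P hP => ?_⟩
  obtain ⟨Q, -, hQ, hcard⟩ := hpig ∅ K P (by simpa using hP)
  have : Q.card ≤ 1 := Finset.card_le_one.2 fun x hx y hy => by
    by_contra hxy
    obtain ⟨s, hs, -⟩ := hQ x hx y hy hxy
    exact absurd hs (Finset.notMem_empty s)
  nlinarith [Nat.zero_le (C ^ K.card)]

theorem exists_maximal_separatedOn [CompactSpace X] {δ : ℝ} (hδ : 0 < δ) (K : Finset Γ) :
    ∃ P : Finset X, IsSeparatedOn δ K P ∧
      ∀ x : X, ∃ p ∈ P, ∀ s ∈ K, dist (s • x) (s • p) ≤ δ := by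
  obtain ⟨C, -, hbdd⟩ := exists_card_separatedOn_le (Γ := Γ) (X := X) hδ
  have hmem := Nat.sSup_mem (s := {k | ∃ P : Finset X, IsSeparatedOn δ K P ∧ P.card = k})
    ⟨0, ∅, by simp [IsSeparatedOn], rfl⟩
    ⟨C ^ K.card, by rintro _ ⟨P, hP, rfl⟩; exact hbdd K P hP⟩
  obtain ⟨P, hP, hPcard⟩ := hmem
  refine ⟨P, hP, fun x => ?_⟩
  by_contra! hx
  have hxP : x ∉ P := fun h => by
    obtain ⟨s, -, hs⟩ := hx x h
    rw [dist_self] at hs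
    linarith
  have hins : IsSeparatedOn δ K (insert x P) := by
    intro p hp q hq hpq
    rcases Finset.mem_insert.1 hp with rfl | hp' <;>
      rcases Finset.mem_insert.1 hq with rfl | hq'
    · exact absurd rfl hpq
    · exact hx q hq'
    · simpa only [dist_comm] using hx p hp'
    · exact hP p hp' q hq' hpq
  have := le_csSup (s := {k | ∃ P : Finset X, IsSeparatedOn δ K P ∧ P.card = k})
    ⟨C ^ K.card, by rintro _ ⟨P, hP, rfl⟩; exact hbdd K P hP⟩ ⟨_, hins, rfl⟩
  rw [← hPcard, Finset.card_insert_of_notMem hxP] at this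
  omega

/-- For an expansive action, separation at the single scale `κ` dominates the entropy of every
finite open cover. -/
theorem exists_subcover_card_le [CompactSpace X] [ContinuousConstSMul Γ X] {κ : ℝ}
    (hκ0 : 0 < κ) (hκ : ∀ x y : X, x ≠ y → ∃ s : Γ, κ < dist (s • x) (s • y))
    {U : Set (Set X)} (hU : IsFiniteOpenCover U) :
    ∃ E : Finset Γ, ∀ K : Finset Γ, ∃ P : Finset X, IsSeparatedOn κ (E * K) P ∧
      ∃ V : Finset (Set X), (V : Set (Set X)) ⊆ joinCover K U ∧
        ⋃₀ (V : Set (Set X)) = Set.univ ∧ V.card ≤ P.card := by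
  obtain ⟨r, hr, hleb⟩ := lebesgue_number_lemma_of_metric_sUnion (isCompact_univ (X := X))
    hU.isOpen hU.sUnion_eq.ge
  choose g hgU hg using fun x => hleb x (Set.mem_univ x)
  obtain ⟨E, hE⟩ := exists_finset_dist_lt hκ hr
  refine ⟨E, fun K => ?_⟩
  obtain ⟨P, hP, hmax⟩ := exists_maximal_separatedOn (X := X) hκ0 (E * K)
  refine ⟨P, hP, P.image fun p => ⋂ s ∈ K, (fun x : X => s • x) ⁻¹' g (s • p), ?_, ?_,
    Finset.card_image_le⟩
  · intro W hW
    obtain ⟨p, -, rfl⟩ := Finset.mem_image.1 (Finset.mem_coe.1 hW)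
    exact ⟨fun s => g (s • p), fun s _ => hgU _, rfl⟩
  · refine Set.eq_univ_of_forall fun x => ?_
    obtain ⟨p, hp, hxp⟩ := hmax x
    refine ⟨_, Finset.mem_coe.2 (Finset.mem_image_of_mem _ hp), Set.mem_iInter₂.2 fun s hs => ?_⟩
    refine hg _ (Metric.mem_ball.2 (hE _ _ fun t ht => ?_))
    rw [smul_smul, smul_smul]
    exact hxp _ (Finset.mul_mem_mul ht hs)

theorem coverNumber_le_card {W : Type v} {U : Set (Set W)} {V : Finset (Set W)}
    (hV : (V : Set (Set W)) ⊆ U) (hcov : ⋃₀ (V : Set (Set W)) = Set.univ) :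
    coverNumber U ≤ V.card :=
  Nat.sInf_le ⟨V, hV, hcov, rfl⟩

theorem exists_card_eq_coverNumber {W : Type v} {U : Set (Set W)}
    (hne : ∃ V : Finset (Set W), (V : Set (Set W)) ⊆ U ∧ ⋃₀ (V : Set (Set W)) = Set.univ) :
    ∃ V : Finset (Set W), (V : Set (Set W)) ⊆ U ∧ ⋃₀ (V : Set (Set W)) = Set.univ ∧
      V.card = coverNumber U := by
  obtain ⟨V, hV, hcov⟩ := hne
  exact Nat.sInf_mem (s := {k | ∃ V : Finset (Set W), (V : Set (Set W)) ⊆ U ∧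
    ⋃₀ (V : Set (Set W)) = Set.univ ∧ V.card = k}) ⟨_, V, hV, hcov, rfl⟩

/-- A member of the join of a cover of mesh at most `δ` contains at most one point of a
`δ`-separated set. -/
theorem card_le_coverNumber {U : Set (Set X)} {δ : ℝ}
    (hdiam : ∀ V ∈ U, ∀ x ∈ V, ∀ y ∈ V, dist x y ≤ δ) {K : Finset Γ}
    (hne : ∃ V : Finset (Set X), (V : Set (Set X)) ⊆ joinCover K U ∧
      ⋃₀ (V : Set (Set X)) = Set.univ) {R : Finset X} (hR : IsSeparatedOn δ K R) :
    R.card ≤ coverNumber (joinCover K U) := by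
  obtain ⟨V, hV, hcov, hcard⟩ := exists_card_eq_coverNumber hne
  have hc : ∀ x : X, ∃ W ∈ V, x ∈ W := fun x => by
    simpa using hcov.ge (Set.mem_univ x)
  choose c hcV hc using hc
  refine (Finset.card_le_card_of_injOn c (fun x _ => hcV x) ?_).trans hcard.le
  intro x hx y hy hxy
  by_contra hne
  obtain ⟨s, hs, hsd⟩ := hR x hx y hy hne
  obtain ⟨d, hd, hW⟩ := hV (hcV x)
  have hx' := hc x
  have hy' := hc y
  rw [← hxy] at hy'
  rw [hW] at hx' hy'
  exact absurd (hdiam _ (hd s hs) _ (Set.mem_iInter₂.1 hx' s hs) _ (Set.mem_iInter₂.1 hy' s hs))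
    (not_le.2 hsd)

theorem exists_finiteOpenCover_dist_le [CompactSpace X] {δ : ℝ} (hδ : 0 < δ) :
    ∃ U : Set (Set X), IsFiniteOpenCover U ∧ ∀ V ∈ U, ∀ x ∈ V, ∀ y ∈ V, dist x y ≤ δ := by
  obtain ⟨t, -, htf, ht⟩ := finite_cover_balls_of_compact (X := X) isCompact_univ (half_pos hδ)
  refine ⟨(fun x => Metric.ball x (δ / 2)) '' t, ⟨htf.image _, ?_, ?_⟩, ?_⟩
  · rintro _ ⟨x, -, rfl⟩
    exact Metric.isOpen_ball
  · rw [Set.sUnion_image]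
    exact Set.univ_subset_iff.1 ht
  · rintro _ ⟨p, -, rfl⟩ x hx y hy
    have := dist_triangle_right x y p
    rw [Metric.mem_ball] at hx hy
    linarith

/-! ### Entropy comparison -/

theorem coverEntropy_nonneg {W : Type v} [MulAction Γ W] (F : ℕ → Finset Γ) (U : Set (Set W)) :
    0 ≤ coverEntropy F U :=
  le_limsup_of_frequently_le (Frequently.of_forall fun n => by
    exact_mod_cast div_nonneg (Real.log_natCast_nonneg _) (Nat.cast_nonneg _))

/-- The separated sets bounding the cover numbers along `F n` have at most `C ^ (|E| |F n|)` points. -/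
theorem coverEntropy_lt_top [CompactSpace X] [ContinuousConstSMul Γ X] (hX : IsExpansive Γ X)
    {F : ℕ → Finset Γ} (hF : ∀ n, (F n).Nonempty) {U : Set (Set X)} (hU : IsFiniteOpenCover U) :
    coverEntropy F U < ⊤ := by
  obtain ⟨κ, hκ0, hκ⟩ := hX
  obtain ⟨E, hE⟩ := exists_subcover_card_le hκ0 hκ hU
  obtain ⟨C, hC, hbdd⟩ := exists_card_separatedOn_le (Γ := Γ) (X := X) hκ0
  refine (limsup_le_of_le (a := ((E.card * Real.log C : ℝ) : EReal)) (h := ?_)).trans_lt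
    (EReal.coe_lt_top _)
  refine Eventually.of_forall fun n => EReal.coe_le_coe_iff.2 ?_
  obtain ⟨P, hP, V, hV, hcov, hcard⟩ := hE (F n)
  have hFn : (0 : ℝ) < (F n).card := by exact_mod_cast (hF n).card_pos
  have hN : coverNumber (joinCover (F n) U) ≤ C ^ (E.card * (F n).card) :=
    ((coverNumber_le_card hV hcov).trans hcard).trans
      ((hbdd _ P hP).trans (Nat.pow_le_pow_right hC Finset.card_mul_le))
  rw [div_le_iff₀ hFn]
  rcases Nat.eq_zero_or_pos (coverNumber (joinCover (F n) U)) with h0 | h0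
  · rw [h0]
    simpa using mul_nonneg (mul_nonneg (Nat.cast_nonneg _) (Real.log_natCast_nonneg C)) hFn.le
  · calc Real.log (coverNumber (joinCover (F n) U))
        ≤ Real.log ((C : ℝ) ^ (E.card * (F n).card)) :=
          Real.log_le_log (by exact_mod_cast h0) (by exact_mod_cast hN)
      _ = E.card * Real.log C * (F n).card := by
          rw [Real.log_pow]
          push_cast
          ring

theorem tendsto_card_mul_sdiff_div {F : ℕ → Finset Γ} (hF : IsLeftFolner F) (D : Finset Γ) :
    Tendsto (fun n => (((D * F n) \ F n).card : ℝ) / (F n).card) atTop (𝓝 0) := by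
  rcases D.eq_empty_or_nonempty with rfl | hD
  · simp
  · refine squeeze_zero (fun n => by positivity) (fun n => ?_) (hF.tendsto D hD)
    gcongr
    exact Finset.subset_union_left

/-- If `T` is pre-injective but not surjective, then every finite open cover of the source has
entropy smaller, by a fixed amount, than that of one fixed cover of the target. -/
theorem surjective_of_preInjective [CompactSpace X] [ContinuousConstSMul Γ X] [CompactSpace Y]
    [ContinuousConstSMul Γ Y] {F : ℕ → Finset Γ} (hF : IsLeftFolner F)
    (hX : IsExpansive Γ X) (hX' : WeakSpecification Γ X)
    (hY : IsExpansive Γ Y) (hY' : WeakSpecification Γ Y)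
    (hent : topEntropy F X = topEntropy F Y)
    (T : X →[Γ] Y) (hT : Continuous T) (hinj : PreInjective Γ T) : Function.Surjective T := by
  by_contra hsurj
  obtain ⟨y₀, hy₀⟩ : ∃ y, y ∉ Set.range T := by
    simpa [Function.Surjective] using hsurj
  have hYexp := hY
  obtain ⟨κ, hκ0, hκ⟩ := hX
  obtain ⟨κ', hκ0', hκ'⟩ := hY
  obtain ⟨D, hD⟩ := exists_image_separatedOn hκ0 hκ hX' hκ0' hκ' T hT hinj
  obtain ⟨C, hC, hpig⟩ := exists_separatedOn_of_union (Γ := Γ) (X := Y) hκ0'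
  obtain ⟨δ, hδ, c, hc, hgain⟩ := exists_separatedOn_card_exp_le hY'
    (isCompact_range hT).isClosed
    (by rintro s _ ⟨x, rfl⟩; exact ⟨s • x, map_smul T s x⟩) hy₀ hκ0'
  obtain ⟨V, hV, hVdiam⟩ := exists_finiteOpenCover_dist_le (X := Y) hδ
  have hC0 : (0 : ℝ) < C := by exact_mod_cast hC
  obtain ⟨x₀⟩ : Nonempty X := by
    obtain ⟨E, -, -, h⟩ := hX' 1 one_pos
    obtain ⟨z, -⟩ := h 0 Fin.elim0 Fin.elim0 fun i => i.elim0
    exact ⟨z⟩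
  have key : ∀ U : Set (Set X), IsFiniteOpenCover U →
      coverEntropy F U ≤ coverEntropy F V + ((-(c / 2) : ℝ) : EReal) := by
    intro U hU
    obtain ⟨E, hE⟩ := exists_subcover_card_le hκ0 hκ hU
    obtain ⟨E', hE'⟩ := exists_subcover_card_le hκ0' hκ' hV
    have hsmall : Tendsto (fun n => (((D * E * F n) \ F n).card : ℝ) / (F n).card * Real.log C)
        atTop (𝓝 0) := by
      simpa using (tendsto_card_mul_sdiff_div hF (D * E)).mul_const (Real.log C)
    have hle : coverEntropy F U ≤ limsup ((fun n =>
        ((Real.log (coverNumber (joinCover (F n) V) : ℝ) / ((F n).card : ℝ) : ℝ) : EReal)) +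
          fun _ => ((-(c / 2) : ℝ) : EReal)) atTop := by
      refine limsup_le_limsup ?_
      -- Half of the exponential gain `c` absorbs the Følner boundary factor.
      filter_upwards [hsmall.eventually_lt_const (half_pos hc)] with n hn
      rw [Pi.add_apply, ← EReal.coe_add, EReal.coe_le_coe_iff]
      have hFn : (0 : ℝ) < (F n).card := by exact_mod_cast (hF.nonempty n).card_pos
      obtain ⟨P, hP, W, hW, hcov, hcard⟩ := hE (F n)
      obtain ⟨Q, hQT, hQ, hQcard⟩ := hD _ P hP
      obtain ⟨Q', hQ'Q, hQ', hQ'card⟩ := hpig (F n) ((D * E * F n) \ F n) Q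
        fun x hx y hy hxy => by
          obtain ⟨s, hs, hsd⟩ := hQ x hx y hy hxy
          exact ⟨s, by simp [mul_assoc, hs], hsd⟩
      obtain ⟨R, hR, hRcard⟩ := hgain (F n) Q' (fun q hq => hQT q (hQ'Q hq)) hQ'
      have hRV : R.card ≤ coverNumber (joinCover (F n) V) := by
        obtain ⟨-, -, V', hV', hcov', -⟩ := hE' (F n)
        exact card_le_coverNumber hVdiam ⟨V', hV', hcov'⟩ hR
      have hUQ : coverNumber (joinCover (F n) U) ≤
          Q'.card * C ^ ((D * E * F n) \ F n).card :=
        (coverNumber_le_card hW hcov).trans ((hcard.trans hQcard.ge).trans hQ'card)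
      have hUpos : 0 < coverNumber (joinCover (F n) U) := by
        obtain ⟨W', -, hcov', hcard'⟩ := exists_card_eq_coverNumber ⟨W, hW, hcov⟩
        obtain ⟨A, hA, -⟩ := hcov'.ge (Set.mem_univ x₀)
        exact hcard' ▸ Finset.card_pos.2 ⟨A, hA⟩
      have hprod : (coverNumber (joinCover (F n) U) : ℝ) * Real.exp (c * (F n).card) ≤
          coverNumber (joinCover (F n) V) * (C : ℝ) ^ ((D * E * F n) \ F n).card := by
        calc (coverNumber (joinCover (F n) U) : ℝ) * Real.exp (c * (F n).card)
            ≤ (Q'.card * (C : ℝ) ^ ((D * E * F n) \ F n).card) * Real.exp (c * (F n).card) := by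
              gcongr
              exact_mod_cast hUQ
          _ = (Q'.card * Real.exp (c * (F n).card)) * (C : ℝ) ^ ((D * E * F n) \ F n).card := by
              ring
          _ ≤ _ := by
              gcongr
              exact hRcard.trans (by exact_mod_cast hRV)
      have hU0 : (0 : ℝ) < coverNumber (joinCover (F n) U) := by exact_mod_cast hUpos
      have hV0 : (0 : ℝ) < coverNumber (joinCover (F n) V) := by
        by_contra! hV0
        have h1 : 0 < (coverNumber (joinCover (F n) U) : ℝ) * Real.exp (c * (F n).card) := by
          positivity
        have h2 : 0 < (C : ℝ) ^ ((D * E * F n) \ F n).card := by positivity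
        nlinarith
      have hlog := Real.log_le_log (by positivity) hprod
      rw [Real.log_mul hU0.ne' (Real.exp_ne_zero _), Real.log_exp,
        Real.log_mul hV0.ne' (by positivity), Real.log_pow] at hlog
      rw [div_mul_eq_mul_div, div_lt_iff₀ hFn] at hn
      rw [div_add' _ _ _ hFn.ne', div_le_div_iff_of_pos_right hFn]
      linarith
    refine hle.trans ((EReal.limsup_add_le ?_ ?_).trans_eq ?_)
    · right; simp
    · right; simp
    · rw [limsup_const]; rfl
  obtain ⟨L, hL⟩ : ∃ L : ℝ, coverEntropy F V = L :=
    ⟨_, (EReal.coe_toReal (coverEntropy_lt_top hYexp hF.nonempty hV).ne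
      (EReal.bot_lt_zero.trans_le (coverEntropy_nonneg F V)).ne').symm⟩
  have h1 : topEntropy F X ≤ ((L - c / 2 : ℝ) : EReal) := iSup₂_le fun U hU => by
    refine (key U hU).trans_eq ?_
    rw [hL, ← EReal.coe_add, sub_eq_add_neg]
  have h2 : (L : EReal) ≤ topEntropy F Y := hL.symm.trans_le
    (le_iSup₂ (f := fun (U : Set (Set Y)) (_ : IsFiniteOpenCover U) => coverEntropy F U) V hV)
  have h3 := EReal.coe_le_coe_iff.1 ((h2.trans hent.ge).trans h1)
  linarith

end Separated

end GardenOfEden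

theorem theorem3p3 (Γ : Type*) [Group Γ] [Countable Γ] (hΓ : IsAmenable Γ) :
    (∀ (F : ℕ → Finset Γ), IsLeftFolner F →
      ∀ (X : Type*) [MetricSpace X] [CompactSpace X] [MulAction Γ X] [ContinuousConstSMul Γ X]
        (Y : Type*) [MetricSpace Y] [CompactSpace Y] [MulAction Γ Y] [ContinuousConstSMul Γ Y],
        IsExpansive Γ X → WeakSpecification Γ X →
        IsExpansive Γ Y → WeakSpecification Γ Y →
        topEntropy F X = topEntropy F Y →
        ∀ T : X →[Γ] Y, Continuous T → PreInjective Γ T → Function.Surjective T) ∧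
    (∀ (Z : Type*) [MetricSpace Z] [CompactSpace Z] [MulAction Γ Z] [ContinuousConstSMul Γ Z],
        IsExpansive Γ Z → WeakSpecification Γ Z →
        MyhillProperty Γ Z ∧ IsSurjunctive Γ Z) := by
  refine ⟨fun F hF X _ _ _ _ Y _ _ _ _ hX hX' hY hY' hent T hT hinj =>
    surjective_of_preInjective hF hX hX' hY hY' hent T hT hinj, fun Z _ _ _ _ hZ hZ' => ?_⟩
  obtain ⟨F, hF⟩ := hΓ
  have hMyhill : MyhillProperty Γ Z := fun T hT hinj =>
    surjective_of_preInjective hF hZ hZ' hZ hZ' rfl T hT hinj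
  exact ⟨hMyhill, fun T hT hinj => hMyhill T hT fun _ => hinj.injOn⟩
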